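/- Let $S$ be a closed symmetric operator with dense domain $\mathrm{dom}(S)$ in a separable complex Hilbert space $\mathcal H$. Suppose that $S$ has finite equal deficiency indices $(n,n)$, i.e. $\dim\ker(S^*-i)=\dim\ker(S^*+i)=n<\infty$; that $S$ is simple, i.e. there is no nonzero closed invariant subspace of $\mathcal H$ on which $S$ restricts to a self-adjoint operator; and that $S$ is regular, i.e. for every $z\in\mathbb C$ the operator $S-z$ has a bounded inverse defined on its range. Let $\mathfrak S$ be the set of all self-adjoint extensions of $S$ within $\mathcal H$. For a symmetric operator $T$, a unit vector $\phi\in\mathrm{dom}(T)$ and $t\in\mathbb R$ put $$\Delta T[\phi]=\sqrt{\langle T\phi,T\phi\rangle-\langle T\phi,\phi\rangle^2},\qquad \Delta T_t=\inf\{\Delta T[\phi] : \phi\in\mathrm{dom}(T),\ \|\phi\|=1,\ \langle T\phi,\phi\rangle=t\},$$ with $\inf\emptyset=+\infty$. Then for every $t\in\mathbb R$ $$\Delta S_t\ \ge\ \sup_{S'\in\mathfrak S}\Delta S'_t\ =\ \sup_{S'\in\mathfrak S}\Big(\min_{\lambda,\mu\in\sigma(S'),\ \lambda\le t\le\mu}\sqrt{|\lambda-t|\,|\mu-t|}\Big),$$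 and the supremum over $S'$ is attained (is a maximum) whenever some unit vector $\phi\in\mathrm{dom}(S)$ has $\langle S\phi,\phi\rangle=t$. Moreover, for each $S'\in\mathfrak S$, $$\Delta S'_t=\min_{\lambda,\mu\in\sigma(S'),\ \lambda\le t\le\mu}\sqrt{|\lambda-t|\,|\mu-t|},$$ where the minimum is attained if there are $\lambda,\mu\in\sigma(S')$ with $\lambda\le t\le\mu$, and is understood as $+\infty$ otherwise. -/

import Mathlib

open scoped ENNReal

noncomputable section

namespace SymmetricOperator

variable {H : Type*} [NormedAddCommGroup H] [InnerProductSpace ℂ H]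

/-- `S` is a symmetric operator: it is densely defined and `⟪S x, y⟫ = ⟪x, S y⟫` for all `x`, `y`
in its domain. -/
def IsSymmetric (S : H →ₗ.[ℂ] H) : Prop :=
  Dense (S.domain : Set H) ∧ S.IsFormalAdjoint S

/-- The linear map `S - z`, defined on the domain of `S`. -/
def shift (S : H →ₗ.[ℂ] H) (z : ℂ) : S.domain →ₗ[ℂ] H :=
  S.toFun - z • S.domain.subtype

/-- The eigenspace `ker (S - z)`, as a subspace of `H`. -/
def eigenspace (S : H →ₗ.[ℂ] H) (z : ℂ) : Submodule ℂ H :=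
  (LinearMap.ker (shift S z)).map S.domain.subtype

/-- `S` has the finite deficiency indices `(p, m)`: the deficiency subspaces `ker (S† - i)` and
`ker (S† + i)` have dimension `p` and `m`. -/
def HasDeficiencyIndices [CompleteSpace H] (S : H →ₗ.[ℂ] H) (p m : ℕ) : Prop :=
  Module.rank ℂ (eigenspace S.adjoint Complex.I) = p ∧
    Module.rank ℂ (eigenspace S.adjoint (-Complex.I)) = m

/-- `z` is a point of regular type for `S`: the operator `S - z` has a bounded inverse, defined on
the range of `S - z`. -/
def IsRegularType (S : H →ₗ.[ℂ] H) (z : ℂ) : Prop :=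
  ∃ C : ℝ, ∀ x : S.domain, ‖(x : H)‖ ≤ C * ‖shift S z x‖

/-- `S` is regular: every complex number is a point of regular type for `S`. -/
def IsRegular (S : H →ₗ.[ℂ] H) : Prop :=
  ∀ z : ℂ, IsRegularType S z

/-- The restriction of `S` to an invariant subspace `M`, as an operator in `M` with domain
`dom S ∩ M`. -/
def restrictTo (S : H →ₗ.[ℂ] H) (M : Submodule ℂ H)
    (hM : ∀ x : S.domain, (x : H) ∈ M → S x ∈ M) : M →ₗ.[ℂ] M where
  domain := S.domain.comap M.subtype
  toFun :=
    { toFun := fun x => ⟨S ⟨(x : M), x.2⟩, hM ⟨(x : M), x.2⟩ (x : M).2⟩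
      map_add' := fun x y => Subtype.ext (S.map_add ⟨(x : M), x.2⟩ ⟨(y : M), y.2⟩)
      map_smul' := fun c x => Subtype.ext (S.map_smul c ⟨(x : M), x.2⟩) }

/-- `S` is simple: there is no nonzero closed subspace `M` of `H`, invariant under `S`, such that
the restriction of `S` to `M` is a self-adjoint operator in the Hilbert space `M`. -/
def IsSimple (S : H →ₗ.[ℂ] H) : Prop :=
  ∀ (M : Submodule ℂ H) (_ : CompleteSpace M) (hM : ∀ x : S.domain, (x : H) ∈ M → S x ∈ M),
    IsSelfAdjoint (restrictTo S M hM) → M = ⊥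

/-- The set of all self-adjoint extensions of `S` within `H`. -/
def selfAdjointExtensions [CompleteSpace H] (S : H →ₗ.[ℂ] H) : Set (H →ₗ.[ℂ] H) :=
  {S' | S ≤ S' ∧ IsSelfAdjoint S'}

/-- The spectrum of `S`: the set of all `z` such that `S - z` does not have a bounded inverse
defined on all of `H`. -/
def spectrum (S : H →ₗ.[ℂ] H) : Set ℂ :=
  {z | ¬ ∃ R : H →L[ℂ] H, (∀ x : S.domain, R (shift S z x) = x) ∧
    ∀ y : H, ∃ x : S.domain, (x : H) = R y ∧ shift S z x = y}

/-- The expectation value `⟪φ, S φ⟫` (a real number when `S` is symmetric). -/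
def expectation (S : H →ₗ.[ℂ] H) (φ : S.domain) : ℝ :=
  (inner ℂ (φ : H) (S φ)).re

/-- The uncertainty `ΔS[φ] = √(⟪S φ, S φ⟫ - ⟪S φ, φ⟫ ^ 2)` of a unit vector `φ`. -/
def uncertainty (S : H →ₗ.[ℂ] H) (φ : S.domain) : ℝ :=
  √(‖S φ‖ ^ 2 - expectation S φ ^ 2)

/-- The minimum uncertainty `ΔS_t`: the infimum of `ΔS[φ]` over all unit vectors `φ` in the domain
of `S` with expectation value `t`. It is `∞` if there is no such vector. -/
def minUncertainty (S : H →ₗ.[ℂ] H) (t : ℝ) : ℝ≥0∞ :=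
  ⨅ (φ : S.domain) (_ : ‖(φ : H)‖ = 1) (_ : expectation S φ = t), ENNReal.ofReal (uncertainty S φ)

/-- The set of all numbers `√(|a - t| |b - t|)`, where `a ≤ t ≤ b` are points of the spectrum
of `S`. -/
def spectralPairValues (S : H →ₗ.[ℂ] H) (t : ℝ) : Set ℝ≥0∞ :=
  {r | ∃ a b : ℝ, (a : ℂ) ∈ spectrum S ∧ (b : ℂ) ∈ spectrum S ∧ a ≤ t ∧ t ≤ b ∧
    r = ENNReal.ofReal √(|a - t| * |b - t|)}

end SymmetricOperator

end

namespace SymmetricOperator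

open Complex

variable {H : Type*} [NormedAddCommGroup H] [InnerProductSpace ℂ H]

/-! For a self-adjoint extension `A` of `S`, regularity and finite deficiency make every `ran (A -
s)` closed: it is `ran (S - s)` plus a finite-dimensional space. Hence every real spectral point of
`A` is an eigenvalue (`exists_unit_eigenvector`). If `(a, b)` is a gap of the spectrum around `t`,
then `A - (a + b)/2` is bounded below by `(b - a)/2`, which for unit vectors of mean `t` says that
the variance is at least `(t - a)(b - t)` (`gap_le_variance`). Superposing eigenvectors for the
spectral points nearest to `t` on either side gives equality (`minUncertainty_le_of_eigenvectors`).
The bound for `S` itself is monotonicity, because an extension has more trial vectors.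

Attainment is a compactness argument. Along an ultrafilter, the graphs of a maximizing sequence of
extensions have a limit that contains the graph of an extension `B` (`exists_graph_limit`). A unit
vector of mean `t` in `dom B` is a limit of graph points of the `A k`, but their means only tend to
`t`. Since the form of `S - t` takes both signs on `dom S`, a vanishing correction from `dom S`
restores the mean exactly (`exists_correction`). So no variance for `B` lies below the supremum. -/

lemma shift_apply (S : H →ₗ.[ℂ] H) (z : ℂ) (x : S.domain) : shift S z x = S x - z • (x : H) := rfl

/-! ### Resolvents, ranges and eigenspaces in terms of graphs -/

/-- `R` is the resolvent `(A - z)⁻¹`, expressed through the graph of `A`. -/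
def IsResolventAt (A : H →ₗ.[ℂ] H) (z : ℂ) (R : H →L[ℂ] H) : Prop :=
  (∀ x y, (x, y) ∈ A.graph → R (y - z • x) = x) ∧ ∀ y, (R y, y + z • R y) ∈ A.graph

lemma notMem_spectrum_iff {A : H →ₗ.[ℂ] H} {z : ℂ} :
    z ∉ spectrum A ↔ ∃ R, IsResolventAt A z R := by
  simp only [spectrum, Set.mem_ofPred_eq, not_not]
  refine exists_congr fun R => and_congr ⟨fun h x y hxy => ?_, fun h x => ?_⟩
    (forall_congr' fun y => ⟨?_, fun h => ?_⟩)
  · obtain ⟨u, rfl, rfl⟩ := (LinearPMap.mem_graph_iff A).1 hxy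
    exact h u
  · exact h _ _ (A.mem_graph x)
  · rintro ⟨x, hx, hy⟩
    rw [shift_apply, sub_eq_iff_eq_add] at hy
    rw [← hx, ← hy]
    exact A.mem_graph x
  · obtain ⟨u, hu, hu'⟩ := (LinearPMap.mem_graph_iff A).1 h
    exact ⟨u, hu, by rw [shift_apply, hu', hu, add_sub_cancel_right]⟩

lemma mem_range_shift {S : H →ₗ.[ℂ] H} {z : ℂ} {w : H} :
    w ∈ LinearMap.range (shift S z) ↔ ∃ x y, (x, y) ∈ S.graph ∧ y - z • x = w := by
  constructor
  · rintro ⟨x, rfl⟩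
    exact ⟨x, S x, S.mem_graph x, rfl⟩
  · rintro ⟨x, y, hxy, rfl⟩
    obtain ⟨u, rfl, rfl⟩ := (LinearPMap.mem_graph_iff S).1 hxy
    exact ⟨u, rfl⟩

lemma mem_eigenspace {S : H →ₗ.[ℂ] H} {z : ℂ} {x : H} :
    x ∈ eigenspace S z ↔ (x, z • x) ∈ S.graph := by
  rw [eigenspace, Submodule.mem_map, LinearPMap.mem_graph_iff]
  refine exists_congr fun u => ?_
  rw [LinearMap.mem_ker, shift_apply, sub_eq_zero, and_comm]
  constructor
  · rintro ⟨rfl, h⟩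
    exact ⟨rfl, h⟩
  · rintro ⟨rfl, h⟩
    exact ⟨rfl, h⟩

/-- The graph is complete, and regular type makes `(x, y) ↦ y - z • x` bounded below on it in the
graph norm. Such a map has closed range. -/
lemma isClosed_range_shift [CompleteSpace H] {S : H →ₗ.[ℂ] H} (hS : S.IsClosed) {z : ℂ}
    (hz : IsRegularType S z) : IsClosed (LinearMap.range (shift S z) : Set H) := by
  obtain ⟨C, hC⟩ := hz
  have : CompleteSpace S.graph := IsClosed.completeSpace_coe (hs := hS)
  let f : S.graph →L[ℂ] H := (ContinuousLinearMap.snd ℂ H H - z • ContinuousLinearMap.fst ℂ H H).comp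
    S.graph.subtypeL
  have hf : ∀ p, f p = p.1.2 - z • p.1.1 := fun p => rfl
  have hr : (LinearMap.range (shift S z) : Set H) = Set.range f := by
    ext w
    rw [SetLike.mem_coe, mem_range_shift]
    constructor
    · rintro ⟨x, y, h, rfl⟩
      exact ⟨⟨(x, y), h⟩, rfl⟩
    · rintro ⟨⟨⟨x, y⟩, h⟩, rfl⟩
      exact ⟨x, y, h, rfl⟩
  rw [hr]
  refine (AddMonoidHomClass.antilipschitz_of_bound f
    (K := ⟨max C 0 + (1 + ‖z‖ * max C 0), by positivity⟩) fun p => ?_).isClosed_range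
    f.uniformContinuous
  obtain ⟨⟨x, y⟩, h⟩ := p
  have h1 : ‖x‖ ≤ max C 0 * ‖y - z • x‖ := by
    obtain ⟨u, rfl, rfl⟩ := (LinearPMap.mem_graph_iff S).1 h
    exact (hC u).trans (mul_le_mul_of_nonneg_right (le_max_left _ _) (norm_nonneg _))
  have h2 : ‖y‖ ≤ ‖y - z • x‖ + ‖z‖ * ‖x‖ := by
    rw [← norm_smul]
    simpa using norm_add_le (y - z • x) (z • x)
  have h3 := mul_le_mul_of_nonneg_left h1 (norm_nonneg z)
  have h4 : 0 ≤ max C 0 := le_max_right _ _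
  have h5 := norm_nonneg (y - z • x)
  have h6 := norm_nonneg z
  have h7 : 0 ≤ ‖z‖ * max C 0 * ‖y - z • x‖ := by positivity
  have h8 : 0 ≤ max C 0 * ‖y - z • x‖ := by positivity
  rw [hf]
  change max ‖x‖ ‖y‖ ≤ (max C 0 + (1 + ‖z‖ * max C 0)) * ‖y - z • x‖
  refine max_le ?_ ?_ <;> nlinarith

/-- Closed graph theorem: a closed operator `A` with `A - z` bijective has a bounded resolvent. -/
lemma exists_isResolventAt [CompleteSpace H] {A : H →ₗ.[ℂ] H} (hA : A.IsClosed) {z : ℂ}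
    (hinj : ∀ x, (x, z • x) ∈ A.graph → x = 0) (hsurj : LinearMap.range (shift A z) = ⊤) :
    ∃ R, IsResolventAt A z R := by
  have hi : LinearMap.ker (shift A z) = ⊥ := by
    rw [LinearMap.ker_eq_bot']
    intro x hx
    rw [shift_apply, sub_eq_zero] at hx
    have := hinj x (by rw [← hx]; exact A.mem_graph x)
    exact Subtype.ext this
  let e := LinearEquiv.ofBijective (shift A z)
    ⟨LinearMap.ker_eq_bot.1 hi, LinearMap.range_eq_top.1 hsurj⟩
  have he : ∀ x, e x = A x - z • (x : H) := fun x => rfl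
  let g : H →ₗ[ℂ] H := A.domain.subtype ∘ₗ e.symm.toLinearMap
  have hg : ∀ y, (g y, y + z • g y) ∈ A.graph := by
    intro y
    have : y = A (e.symm y) - z • (e.symm y : H) := by rw [← he]; simp
    have h2 : y + z • g y = A (e.symm y) := eq_sub_iff_add_eq.1 this
    rw [h2]
    exact A.mem_graph (e.symm y)
  have hg' : ∀ x y, (x, y) ∈ A.graph → g (y - z • x) = x := by
    intro x y hxy
    obtain ⟨u, rfl, rfl⟩ := (LinearPMap.mem_graph_iff A).1 hxy
    rw [← he]
    simp [g]
  have hcl : IsClosed (g.graph : Set (H × H)) := by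
    have : (g.graph : Set (H × H)) =
        (fun p : H × H => (p.2, p.1 + z • p.2)) ⁻¹' (A.graph : Set (H × H)) := by
      ext ⟨y, x⟩
      simp only [SetLike.mem_coe, LinearMap.mem_graph_iff, Set.mem_preimage]
      constructor
      · rintro rfl
        exact hg y
      · intro h
        simpa using (hg' _ _ h).symm
    rw [this]
    exact hA.preimage (by fun_prop)
  exact ⟨⟨g, g.continuous_of_isClosed_graph hcl⟩, hg', hg⟩

lemma mem_eigenspace_adjoint [CompleteSpace H] {S : H →ₗ.[ℂ] H} (hS : Dense (S.domain : Set H))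
    {z : ℂ} : eigenspace S.adjoint z = (LinearMap.range (shift S (starRingEnd ℂ z)))ᗮ := by
  ext u
  rw [mem_eigenspace, LinearPMap.adjoint_graph_eq_graph_adjoint hS, Submodule.mem_adjoint_iff,
    Submodule.mem_orthogonal]
  simp only [mem_range_shift]
  constructor
  · rintro h _ ⟨x, y, hxy, rfl⟩
    have := h x y hxy
    rw [inner_sub_left, inner_smul_left, Complex.conj_conj]
    rwa [inner_smul_right] at this
  · rintro h x y hxy
    have := h _ ⟨x, y, hxy, rfl⟩
    rw [inner_sub_left, inner_smul_left, Complex.conj_conj] at this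
    rwa [inner_smul_right]

/-! ### Symmetric and self-adjoint operators off the real axis -/

/-- The graph of a symmetric operator consists of pairs satisfying the symmetry relation. -/
lemma inner_eq_of_mem_graph {A : H →ₗ.[ℂ] H} (hA : A.IsFormalAdjoint A) {a b c d : H}
    (h : (a, b) ∈ A.graph) (h' : (c, d) ∈ A.graph) : inner ℂ b c = inner ℂ a d := by
  obtain ⟨u, rfl, rfl⟩ := (LinearPMap.mem_graph_iff A).1 h
  obtain ⟨v, rfl, rfl⟩ := (LinearPMap.mem_graph_iff A).1 h'
  exact hA u v

lemma isFormalAdjoint_of_isSelfAdjoint [CompleteSpace H] {A : H →ₗ.[ℂ] H} (hA : IsSelfAdjoint A) :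
    A.IsFormalAdjoint A := by
  have := LinearPMap.adjoint_isFormalAdjoint hA.dense_domain
  rwa [LinearPMap.isSelfAdjoint_def.1 hA] at this

/-- Pythagoras: the cross term vanishes because `⟪y, x⟫` is real. -/
lemma norm_sq_shift {A : H →ₗ.[ℂ] H} (hA : A.IsFormalAdjoint A) {x y : H}
    (h : (x, y) ∈ A.graph) (z : ℂ) :
    ‖y - z • x‖ ^ 2 = ‖y - (z.re : ℂ) • x‖ ^ 2 + (z.im * ‖x‖) ^ 2 := by
  have hz : y - z • x = (y - (z.re : ℂ) • x) - (z.im : ℂ) • (I • x) := by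
    conv_lhs => rw [← Complex.re_add_im z]
    rw [add_smul, mul_smul]; abel
  have h0 : (inner ℂ (y - (z.re : ℂ) • x) ((z.im : ℂ) • (I • x))).re = 0 := by
    have hs := inner_eq_of_mem_graph hA h h
    have him : (inner ℂ y x : ℂ).im = 0 := by
      rw [← Complex.conj_eq_iff_im, inner_conj_symm, hs]
    rw [inner_smul_right, inner_smul_right, inner_sub_left, inner_smul_left,
      inner_self_eq_norm_sq_to_K]
    simp [him, ← Complex.ofReal_pow]
  rw [hz, @norm_sub_sq ℂ]
  simp only [RCLike.re_to_complex, h0, norm_smul, Complex.norm_I, one_mul, Complex.norm_real]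
  rw [mul_pow, mul_pow, Real.norm_eq_abs, sq_abs]
  ring

lemma isRegularType_of_im_ne_zero {A : H →ₗ.[ℂ] H} (hA : A.IsFormalAdjoint A) {z : ℂ}
    (hz : z.im ≠ 0) : IsRegularType A z := by
  refine ⟨|z.im|⁻¹, fun x => ?_⟩
  have h := norm_sq_shift hA (A.mem_graph x) z
  rw [← shift_apply] at h
  rw [inv_mul_eq_div, le_div_iff₀ (abs_pos.2 hz), mul_comm]
  refine abs_le_of_sq_le_sq' ?_ (norm_nonneg _) |>.2
  rw [mul_pow, sq_abs, ← mul_pow, h]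
  nlinarith [sq_nonneg ‖A x - (z.re : ℂ) • (x : H)‖]

lemma range_shift_eq_top [CompleteSpace H] {A : H →ₗ.[ℂ] H} (hA : IsSelfAdjoint A) {z : ℂ}
    (hcl : IsClosed (LinearMap.range (shift A z) : Set H))
    (hker : ∀ x, (x, (starRingEnd ℂ z) • x) ∈ A.graph → x = 0) :
    LinearMap.range (shift A z) = ⊤ := by
  have : CompleteSpace (LinearMap.range (shift A z)) := IsClosed.completeSpace_coe (hs := hcl)
  rw [← Submodule.orthogonal_eq_bot_iff]
  have := mem_eigenspace_adjoint hA.dense_domain (z := starRingEnd ℂ z)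
  rw [Complex.conj_conj] at this
  rw [← this, Submodule.eq_bot_iff]
  intro x hx
  rw [mem_eigenspace, LinearPMap.isSelfAdjoint_def.1 hA] at hx
  exact hker x hx

lemma eq_zero_of_isRegularType {A : H →ₗ.[ℂ] H} {z : ℂ} (hz : IsRegularType A z) {x : H}
    (h : (x, z • x) ∈ A.graph) : x = 0 := by
  obtain ⟨C, hC⟩ := hz
  obtain ⟨u, rfl, hu⟩ := (LinearPMap.mem_graph_iff A).1 h
  have := hC u
  rw [shift_apply, hu, sub_self, norm_zero, mul_zero] at this
  exact norm_le_zero_iff.1 this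

lemma exists_isResolventAt_of_im_ne_zero [CompleteSpace H] {A : H →ₗ.[ℂ] H} (hA : IsSelfAdjoint A)
    {z : ℂ} (hz : z.im ≠ 0) : ∃ R, IsResolventAt A z R := by
  have hsym := isFormalAdjoint_of_isSelfAdjoint hA
  have hz' : (starRingEnd ℂ z).im ≠ 0 := by simpa using hz
  exact exists_isResolventAt hA.isClosed
    (fun x hx => eq_zero_of_isRegularType (isRegularType_of_im_ne_zero hsym hz) hx)
    (range_shift_eq_top hA (isClosed_range_shift hA.isClosed (isRegularType_of_im_ne_zero hsym hz))
      fun x hx => eq_zero_of_isRegularType (isRegularType_of_im_ne_zero hsym hz') hx)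

/-! ### Construction of self-adjoint extensions -/

/-- A symmetric linear relation `G` containing the graph of a densely defined operator `S`, such
that `G - i` and `G + i` are onto, is the graph of a self-adjoint extension of `S`. -/
lemma exists_selfAdjointExtension_of_graph [CompleteSpace H] {S : H →ₗ.[ℂ] H}
    (hS : Dense (S.domain : Set H)) {G : Submodule ℂ (H × H)} (hSG : S.graph ≤ G)
    (hG : ∀ a b c d, (a, b) ∈ G → (c, d) ∈ G → inner ℂ b c = inner ℂ a d)
    (hm : ∀ w, ∃ x y, (x, y) ∈ G ∧ y - I • x = w) (hp : ∀ w, ∃ x y, (x, y) ∈ G ∧ y + I • x = w) :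
    ∃ A ∈ selfAdjointExtensions S, A.graph = G := by
  -- Symmetry of `G` makes a vector `b` with `(0, b) ∈ G` orthogonal to the dense domain of `S`, so
  -- `G` is single-valued.
  have hfun : ∀ x ∈ G, x.1 = 0 → x.2 = 0 := by
    rintro ⟨a, b⟩ hab (rfl : a = 0)
    refine hS.eq_zero_of_inner_left ℂ (fun v hv => ?_)
    rw [hG _ _ _ _ hab (hSG (S.mem_graph ⟨v, hv⟩)), inner_zero_left]
  have hgr := Submodule.toLinearPMap_graph_eq G hfun
  set A := G.toLinearPMap
  have hle : S ≤ A := LinearPMap.le_of_le_graph (by rwa [hgr])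
  have hd : Dense (A.domain : Set H) := hS.mono hle.1
  refine ⟨A, ⟨hle, ?_⟩, hgr⟩
  rw [LinearPMap.isSelfAdjoint_def]
  refine LinearPMap.eq_of_eq_graph ?_
  rw [LinearPMap.adjoint_graph_eq_graph_adjoint hd, hgr]
  refine le_antisymm ?_ ?_
  · rintro ⟨x, y⟩ hxy
    rw [Submodule.mem_adjoint_iff] at hxy
    obtain ⟨u, v, huv, h⟩ := hm (y - I • x)
    -- The difference `(x - u, I • (x - u))` lies in the adjoint of `G`, so `x - u` is orthogonal to
    -- the range of `G + i`, which is everything.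
    have hx : x = u := by
      obtain ⟨c, d, hcd, h'⟩ := hp (x - u)
      have e1 := hxy _ _ hcd
      have e2 := hG _ _ _ _ hcd huv
      have e3 : y - v = I • (x - u) := by
        rw [smul_sub, sub_eq_sub_iff_sub_eq_sub]
        exact h.symm
      have : inner ℂ (d + I • c) (x - u) = 0 := by
        rw [inner_add_left, inner_smul_left, Complex.conj_I]
        have : inner ℂ d (x - u) - inner ℂ c (y - v) = 0 := by
          rw [inner_sub_right, inner_sub_right]
          dsimp only at e1
          linear_combination e1 - e2
        rw [e3, inner_smul_right] at this
        linear_combination this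
      rw [h', inner_self_eq_zero, sub_eq_zero] at this
      exact this
    subst hx
    have : y = v := by simpa using h.symm
    rwa [this]
  · rintro ⟨x, y⟩ hxy
    rw [Submodule.mem_adjoint_iff]
    intro a b hab
    rw [hG _ _ _ _ hab hxy, sub_self]

lemma finiteDimensional_of_rank_eq {N : Submodule ℂ H} {n : ℕ} (h : Module.rank ℂ N = n) :
    FiniteDimensional ℂ N :=
  Module.finite_of_rank_eq_nat h

lemma inner_eq_of_mem_eigenspace_adjoint [CompleteSpace H] {S : H →ₗ.[ℂ] H}
    (hS : Dense (S.domain : Set H)) {z : ℂ} {u : H} (hu : u ∈ eigenspace S.adjoint z) {a b : H}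
    (h : (a, b) ∈ S.graph) : inner ℂ b u = z * inner ℂ a u := by
  rw [mem_eigenspace, LinearPMap.adjoint_graph_eq_graph_adjoint hS, Submodule.mem_adjoint_iff] at hu
  have := hu a b h
  rw [inner_smul_right] at this
  exact sub_eq_zero.1 this

/-- Von Neumann: an isometry between the deficiency subspaces yields a self-adjoint extension. -/
lemma selfAdjointExtensions_nonempty [CompleteSpace H] {S : H →ₗ.[ℂ] H} (hsymm : IsSymmetric S)
    (hclosed : S.IsClosed) {n : ℕ} (hdef : HasDeficiencyIndices S n n) :
    (selfAdjointExtensions S).Nonempty := by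
  obtain ⟨hS, hsym⟩ := hsymm
  have hf1 := finiteDimensional_of_rank_eq hdef.1
  have hf2 := finiteDimensional_of_rank_eq hdef.2
  have hn1 := Module.finrank_eq_of_rank_eq hdef.1
  have hn2 := Module.finrank_eq_of_rank_eq hdef.2
  let V : eigenspace S.adjoint I ≃ₗᵢ[ℂ] eigenspace S.adjoint (-I) :=
    (stdOrthonormalBasis ℂ _).equiv (stdOrthonormalBasis ℂ _) (finCongr (hn1.trans hn2.symm))
  let V' : eigenspace S.adjoint I →ₗ[ℂ] H :=
    (eigenspace S.adjoint (-I)).subtype ∘ₗ V.toLinearEquiv.toLinearMap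
  have hV' : ∀ x, V' x = V x := fun x => rfl
  -- `S†` acts as `i` on `x` and as `-i` on `V x`, so it sends `x - V x` to `i (x + V x)`. The
  -- extension is `S†` restricted to `dom S` plus these vectors.
  let L : eigenspace S.adjoint I →ₗ[ℂ] H × H :=
    ((eigenspace S.adjoint I).subtype - V').prod (I • ((eigenspace S.adjoint I).subtype + V'))
  have hL : ∀ x, L x = ((x : H) - V x, I • ((x : H) + V x)) := fun x => rfl
  have hcross : ∀ a b, (a, b) ∈ S.graph → ∀ x, inner ℂ b (L x).1 = inner ℂ a (L x).2 := by
    intro a b h x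
    rw [hL]
    dsimp only
    rw [inner_sub_right, inner_smul_right, inner_add_right,
      inner_eq_of_mem_eigenspace_adjoint hS x.2 h, inner_eq_of_mem_eigenspace_adjoint hS (V x).2 h]
    ring
  have hLL : ∀ x x', inner ℂ (L x).2 (L x').1 = inner ℂ (L x).1 (L x').2 := by
    intro x x'
    have : inner ℂ (V x : H) (V x' : H) = inner ℂ (x : H) (x' : H) := by
      rw [← Submodule.coe_inner, ← Submodule.coe_inner, V.inner_map_map]
    rw [hL, hL]
    dsimp only
    rw [inner_smul_right, inner_smul_left, Complex.conj_I, inner_add_right, inner_sub_left,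
      inner_sub_left, inner_sub_right, inner_add_left, inner_add_left, this]
    ring
  suffices ∃ A ∈ selfAdjointExtensions S, A.graph = S.graph ⊔ LinearMap.range L from
    let ⟨A, hA, _⟩ := this
    ⟨A, hA⟩
  refine exists_selfAdjointExtension_of_graph hS le_sup_left ?_ ?_ ?_
  · intro a b c d h h'
    obtain ⟨⟨a, b⟩, hab, _, ⟨x, rfl⟩, h⟩ := Submodule.mem_sup.1 h
    obtain ⟨⟨c, d⟩, hcd, _, ⟨x', rfl⟩, h'⟩ := Submodule.mem_sup.1 h'
    obtain ⟨rfl, rfl⟩ := Prod.ext_iff.1 h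
    obtain ⟨rfl, rfl⟩ := Prod.ext_iff.1 h'
    have e1 := hcross a b hab x'
    have e2 := congrArg (starRingEnd ℂ) (hcross c d hcd x)
    rw [inner_conj_symm, inner_conj_symm] at e2
    have e3 := hLL x x'
    have e4 := inner_eq_of_mem_graph hsym hab hcd
    simp only [Prod.fst_add, Prod.snd_add, inner_add_left, inner_add_right]
    rw [e1, ← e2, e3, e4]
  · intro w
    have : CompleteSpace (LinearMap.range (shift S I)) := IsClosed.completeSpace_coe
      (hs := isClosed_range_shift hclosed (isRegularType_of_im_ne_zero hsym (by simp)))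
    obtain ⟨k, hk, m, hm, rfl⟩ :=
      Submodule.exists_add_mem_mem_orthogonal (K := LinearMap.range (shift S I)) w
    have e := mem_eigenspace_adjoint hS (z := -I)
    rw [map_neg, Complex.conj_I, neg_neg] at e
    rw [← e] at hm
    obtain ⟨a, b, hab, rfl⟩ := mem_range_shift.1 hk
    -- On `L x` the operator minus `i` gives `2i V x`, and plus `i` gives `2i x`; hence the factor
    -- `(2i)⁻¹` here and below.
    obtain ⟨x, hx⟩ := V.surjective ((2 * I)⁻¹ • ⟨m, hm⟩)
    have hx' : (V x : H) = (2 * I)⁻¹ • m := by rw [hx]; rfl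
    refine ⟨a + (L x).1, b + (L x).2, Submodule.add_mem_sup hab ⟨x, rfl⟩, ?_⟩
    rw [hL]
    have : m = (2 * I) • (V x : H) := by
      rw [hx', smul_smul, mul_inv_cancel₀ (by simp), one_smul]
    rw [this]
    module
  · intro w
    have : CompleteSpace (LinearMap.range (shift S (-I))) := IsClosed.completeSpace_coe
      (hs := isClosed_range_shift hclosed (isRegularType_of_im_ne_zero hsym (by simp)))
    obtain ⟨k, hk, m, hm, rfl⟩ :=
      Submodule.exists_add_mem_mem_orthogonal (K := LinearMap.range (shift S (-I))) w
    have e := mem_eigenspace_adjoint hS (z := I)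
    rw [Complex.conj_I] at e
    rw [← e] at hm
    obtain ⟨a, b, hab, rfl⟩ := mem_range_shift.1 hk
    let x : eigenspace S.adjoint I := (2 * I)⁻¹ • ⟨m, hm⟩
    have hx' : (x : H) = (2 * I)⁻¹ • m := rfl
    refine ⟨a + (L x).1, b + (L x).2, Submodule.add_mem_sup hab ⟨x, rfl⟩, ?_⟩
    rw [hL]
    have : m = (2 * I) • (x : H) := by
      rw [hx', smul_smul, mul_inv_cancel₀ (by simp), one_smul]
    rw [this]
    module

/-! ### Real spectral points of an extension are eigenvalues -/

/-- For a regular symmetric operator with finite deficiency index, all ranges `ran (A - z)` of a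
self-adjoint extension `A` are closed. -/
lemma isClosed_range_shift_extension [CompleteSpace H] {S A : H →ₗ.[ℂ] H}
    (hsymm : IsSymmetric S) (hclosed : S.IsClosed) (hreg : IsRegular S)
    (hfin : FiniteDimensional ℂ (eigenspace S.adjoint (-I))) (hA : A ∈ selfAdjointExtensions S)
    (z : ℂ) : IsClosed (LinearMap.range (shift A z) : Set H) := by
  obtain ⟨R, hR, hR'⟩ := exists_isResolventAt_of_im_ne_zero hA.2 (z := I) (by simp)
  have hle := LinearPMap.le_graph_of_le hA.1
  -- `T = (A - z)(A - i)⁻¹`. It maps `ran (S - i)` onto `ran (S - z)`, and the orthogonal complement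
  -- of `ran (S - i)` is finite-dimensional.
  let T : H →ₗ[ℂ] H := LinearMap.id + (I - z) • R.toLinearMap
  have hT : ∀ k, T k = k + (I - z) • R k := fun k => rfl
  have heq : LinearMap.range (shift A z) =
      LinearMap.range (shift S z) ⊔ (eigenspace S.adjoint (-I)).map T := by
    refine le_antisymm ?_ (sup_le ?_ ?_)
    · intro w hw
      obtain ⟨x, y, hxy, rfl⟩ := mem_range_shift.1 hw
      have : CompleteSpace (LinearMap.range (shift S I)) := IsClosed.completeSpace_coe
        (hs := isClosed_range_shift hclosed (hreg I))
      obtain ⟨k, hk, m, hm, h⟩ :=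
        Submodule.exists_add_mem_mem_orthogonal (K := LinearMap.range (shift S I)) (y - I • x)
      have e := mem_eigenspace_adjoint hsymm.1 (z := -I)
      rw [map_neg, Complex.conj_I, neg_neg] at e
      rw [← e] at hm
      obtain ⟨a, b, hab, rfl⟩ := mem_range_shift.1 hk
      have h2 := hR _ _ (A.graph.sub_mem hxy (hle hab))
      have h3 : m = (y - b) - I • (x - a) := by
        rw [← add_right_inj (b - I • a), ← h]
        module
      rw [← h3] at h2
      refine Submodule.mem_sup.2 ⟨_, mem_range_shift.2 ⟨a, b, hab, rfl⟩, _, ⟨m, hm, rfl⟩, ?_⟩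
      rw [hT, h2, h3]
      module
    · rintro w hw
      obtain ⟨x, y, hxy, rfl⟩ := mem_range_shift.1 hw
      exact mem_range_shift.2 ⟨x, y, hle hxy, rfl⟩
    · rintro _ ⟨m, -, rfl⟩
      refine mem_range_shift.2 ⟨_, _, hR' m, ?_⟩
      rw [hT]
      module
  rw [heq]
  have : FiniteDimensional ℂ ((eigenspace S.adjoint (-I)).map T) := inferInstance
  exact Submodule.isClosed_sup_finiteDimensional _ _ (isClosed_range_shift hclosed (hreg z))

/-- Without an eigenvector, `A - s` is injective with closed range whose complement `ker (A - s)` is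
trivial, so it has a bounded inverse. -/
lemma exists_unit_eigenvector [CompleteSpace H] {A : H →ₗ.[ℂ] H} (hA : IsSelfAdjoint A) {s : ℝ}
    (hcl : IsClosed (LinearMap.range (shift A s) : Set H)) (hs : (s : ℂ) ∈ spectrum A) :
    ∃ u, ‖u‖ = 1 ∧ (u, (s : ℂ) • u) ∈ A.graph := by
  by_contra! hcon
  have hker : ∀ x, (x, (s : ℂ) • x) ∈ A.graph → x = 0 := by
    intro x hx
    by_contra hx0
    refine hcon (((‖x‖⁻¹ : ℝ) : ℂ) • x) ?_ ?_
    · rw [norm_smul, Complex.norm_real, norm_inv, norm_norm,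
        inv_mul_cancel₀ (norm_ne_zero_iff.2 hx0)]
    · have := A.graph.smul_mem ((‖x‖⁻¹ : ℝ) : ℂ) hx
      rwa [Prod.smul_mk, smul_comm] at this
  have := exists_isResolventAt hA.isClosed hker
    (range_shift_eq_top hA hcl (by rwa [Complex.conj_ofReal]))
  exact notMem_spectrum_iff.2 this hs

/-! ### Spectral gaps bound the variance from below -/

lemma isSelfAdjoint_resolvent [CompleteSpace H] {A : H →ₗ.[ℂ] H} (hA : IsSelfAdjoint A) {c : ℝ}
    {R : H →L[ℂ] H} (hR : IsResolventAt A c R) : IsSelfAdjoint R := by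
  rw [ContinuousLinearMap.isSelfAdjoint_iff_isSymmetric]
  intro x y
  have := inner_eq_of_mem_graph (isFormalAdjoint_of_isSelfAdjoint hA) (hR.2 x) (hR.2 y)
  rw [inner_add_left, inner_add_right, inner_smul_left, inner_smul_right, Complex.conj_ofReal] at this
  change inner ℂ (R x) y = inner ℂ x (R y)
  linear_combination -this

/-- The norm of the self-adjoint `R` is its spectral radius. A spectral value `q` of `R` with `|q| >
r⁻¹` would put `c + q⁻¹` in the spectrum of `A`, within distance `r` of `c`. -/
lemma norm_resolvent_le [CompleteSpace H] {A : H →ₗ.[ℂ] H} (hA : IsSelfAdjoint A) {c r : ℝ}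
    (hr : 0 < r) (hgap : ∀ s : ℝ, |s - c| < r → (s : ℂ) ∉ spectrum A)
    {R : H →L[ℂ] H} (hR : IsResolventAt A c R) : ‖R‖ ≤ r⁻¹ := by
  have hRs := isSelfAdjoint_resolvent hA hR
  have h : spectralRadius ℂ R ≤ ENNReal.ofReal r⁻¹ := by
    refine iSup₂_le fun κ hκ => ?_
    have hre := hRs.mem_spectrum_eq_re hκ
    rw [hre] at hκ ⊢
    set q := κ.re
    change ‖(q : ℂ)‖ₑ ≤ _
    rw [← ofReal_norm, Complex.norm_real, Real.norm_eq_abs]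
    refine ENNReal.ofReal_le_ofReal ?_
    by_contra! hlt
    have hq : q ≠ 0 := by
      rintro h0
      rw [h0, abs_zero] at hlt
      exact absurd hlt (not_lt.2 (inv_pos.2 hr).le)
    have hqC : (q : ℂ) ≠ 0 := by exact_mod_cast hq
    have hs := hgap (c + q⁻¹) (by
      rw [add_sub_cancel_left, abs_inv]
      exact inv_lt_of_inv_lt₀ hr hlt)
    obtain ⟨Q, hQ, hQ'⟩ := notMem_spectrum_iff.1 hs
    push_cast at hQ hQ'
    refine hκ ?_
    rw [_root_.spectrum.mem_resolventSet_iff, ContinuousLinearMap.isUnit_iff_bijective]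
    -- Since `f + c • R f = A (R f)`, this reads `q - R = q (A - c - q⁻¹) R`, and both factors on
    -- the right are invertible.
    have key : ∀ f, (algebraMap ℂ (H →L[ℂ] H) q - R) f
        = (q : ℂ) • (f + (c : ℂ) • R f - ((c : ℂ) + (q : ℂ)⁻¹) • R f) := by
      intro f
      rw [Algebra.algebraMap_eq_smul_one]
      simp only [sub_apply, smul_apply,
        one_apply_eq_self, add_smul, smul_sub, smul_add, smul_inv_smul₀ hqC]
      abel
    constructor
    · refine (injective_iff_map_eq_zero _).2 fun f hf => ?_
      rw [key, smul_eq_zero_iff_right hqC] at hf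
      have h1 := hQ _ _ (hR.2 f)
      rw [hf, map_zero] at h1
      have h2 := hR.2 f
      rw [← h1, smul_zero, add_zero] at h2
      exact A.graph_fst_eq_zero_snd h2 rfl
    · intro y
      have h1 := hQ' ((q : ℂ)⁻¹ • y)
      have h2 := hR.1 _ _ h1
      exact ⟨(q : ℂ)⁻¹ • y + ((c : ℂ) + (q : ℂ)⁻¹) • Q ((q : ℂ)⁻¹ • y) - (c : ℂ) • Q ((q : ℂ)⁻¹ • y),
        by rw [key, h2, sub_add_cancel, add_sub_cancel_right, smul_inv_smul₀ hqC]⟩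
  rw [hRs.spectralRadius_eq_nnnorm] at h
  have h' : ENNReal.ofReal ‖R‖ ≤ ENNReal.ofReal r⁻¹ := by
    rwa [ofReal_norm]
  exact (ENNReal.ofReal_le_ofReal_iff (inv_pos.2 hr).le).1 h'

lemma mul_norm_le_of_gap [CompleteSpace H] {A : H →ₗ.[ℂ] H} (hA : IsSelfAdjoint A) {c r : ℝ}
    (hr : 0 < r) (hgap : ∀ s : ℝ, |s - c| < r → (s : ℂ) ∉ spectrum A) {x y : H}
    (hxy : (x, y) ∈ A.graph) : r * ‖x‖ ≤ ‖y - (c : ℂ) • x‖ := by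
  obtain ⟨R, hR⟩ := notMem_spectrum_iff.1 (hgap c (by simpa using hr))
  have h1 := R.le_of_opNorm_le (norm_resolvent_le hA hr hgap hR) (y - (c : ℂ) • x)
  rw [hR.1 _ _ hxy] at h1
  rwa [inv_mul_eq_div, le_div_iff₀ hr, mul_comm] at h1

lemma norm_sub_smul_sq (x y : H) (t : ℝ) :
    ‖y - (t : ℂ) • x‖ ^ 2 = ‖y‖ ^ 2 - 2 * t * (inner ℂ x y).re + t ^ 2 * ‖x‖ ^ 2 := by
  rw [@norm_sub_sq ℂ, norm_smul, inner_smul_right, Complex.norm_real, mul_pow, Real.norm_eq_abs,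
    sq_abs, RCLike.re_to_complex, Complex.re_ofReal_mul, ← inner_conj_symm, Complex.conj_re]
  ring

/-- If the spectrum of `A` avoids `(a, b) ∋ t`, then `(t - a) (b - t)` bounds the variance of unit
vectors with expectation value `t` from below. -/
lemma gap_le_variance [CompleteSpace H] {A : H →ₗ.[ℂ] H} (hA : IsSelfAdjoint A) {a b t : ℝ}
    (hat : a ≤ t) (htb : t ≤ b) (hgap : ∀ s : ℝ, a < s → s < b → (s : ℂ) ∉ spectrum A) {x y : H}
    (hxy : (x, y) ∈ A.graph) (hx : ‖x‖ = 1) (ht : (inner ℂ x y).re = t) :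
    (t - a) * (b - t) ≤ ‖y - (t : ℂ) • x‖ ^ 2 := by
  rcases (hat.trans htb).eq_or_lt with h | h
  · have : t = a := le_antisymm (h ▸ htb) hat
    rw [this, sub_self, zero_mul]
    positivity
  -- Measured from the midpoint, the second moment is the variance plus `(t - (a + b)/2)²`. The
  -- claim follows from `((b - a)/2)² - (t - (a + b)/2)² = (t - a)(b - t)`.
  have h1 := mul_norm_le_of_gap hA (c := (a + b) / 2) (r := (b - a) / 2) (by linarith)
    (fun s hs => by
      rw [abs_lt] at hs
      exact hgap s (by linarith) (by linarith)) hxy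
  rw [hx, mul_one] at h1
  have h2 := pow_le_pow_left₀ (by linarith) h1 2
  have e1 := norm_sub_smul_sq x y t
  have e2 := norm_sub_smul_sq x y ((a + b) / 2)
  rw [ht, hx] at e1 e2
  rw [e2] at h2
  rw [e1]
  nlinarith

/-! ### Trial vectors and upper bounds -/

lemma uncertainty_eq {A : H →ₗ.[ℂ] H} {φ : A.domain} {t : ℝ} (hφ : ‖(φ : H)‖ = 1)
    (ht : expectation A φ = t) : uncertainty A φ = ‖A φ - (t : ℂ) • (φ : H)‖ := by
  rw [uncertainty, ← Real.sqrt_sq (norm_nonneg (A φ - _)), norm_sub_smul_sq, hφ]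
  change _ = √(‖A φ‖ ^ 2 - 2 * t * expectation A φ + t ^ 2 * 1 ^ 2)
  rw [ht]
  congr 1
  ring

lemma le_minUncertainty {A : H →ₗ.[ℂ] H} {t : ℝ} {c : ℝ≥0∞}
    (h : ∀ x y, (x, y) ∈ A.graph → ‖x‖ = 1 → (inner ℂ x y).re = t →
      c ≤ ENNReal.ofReal ‖y - (t : ℂ) • x‖) : c ≤ minUncertainty A t := by
  refine le_iInf fun φ => le_iInf fun hφ => le_iInf fun ht => ?_
  rw [uncertainty_eq hφ ht]
  exact h _ _ (A.mem_graph φ) hφ ht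

lemma minUncertainty_le_of_unit {A : H →ₗ.[ℂ] H} {t : ℝ} {x y : H} (h : (x, y) ∈ A.graph)
    (hx : ‖x‖ = 1) (ht : (inner ℂ x y).re = t) :
    minUncertainty A t ≤ ENNReal.ofReal ‖y - (t : ℂ) • x‖ := by
  obtain ⟨u, rfl, rfl⟩ := (LinearPMap.mem_graph_iff A).1 h
  rw [← uncertainty_eq hx ht]
  exact iInf_le_of_le u (iInf_le_of_le hx (iInf_le _ ht))

lemma minUncertainty_le {A : H →ₗ.[ℂ] H} {t : ℝ} {x y : H} (h : (x, y) ∈ A.graph)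
    (hx : x ≠ 0) (ht : (inner ℂ x y).re = t * ‖x‖ ^ 2) :
    minUncertainty A t ≤ ENNReal.ofReal (‖y - (t : ℂ) • x‖ / ‖x‖) := by
  have hx0 := norm_ne_zero_iff.2 hx
  have h1 := A.graph.smul_mem ((‖x‖⁻¹ : ℝ) : ℂ) h
  rw [Prod.smul_mk] at h1
  refine (minUncertainty_le_of_unit h1 ?_ ?_).trans (le_of_eq ?_)
  · rw [norm_smul, Complex.norm_real, norm_inv, norm_norm, inv_mul_cancel₀ hx0]
  · rw [inner_smul_left, inner_smul_right, Complex.conj_ofReal, Complex.re_ofReal_mul,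
      Complex.re_ofReal_mul, ht]
    field_simp
  · rw [smul_comm, ← smul_sub, norm_smul, Complex.norm_real, norm_inv, norm_norm, inv_mul_eq_div]

lemma re_inner_real_comb {u v : H} (hu : ‖u‖ = 1) (hv : ‖v‖ = 1) (huv : inner ℂ u v = 0)
    (a b c d : ℝ) : (inner ℂ ((a : ℂ) • u + (b : ℂ) • v) ((c : ℂ) • u + (d : ℂ) • v)).re
      = a * c + b * d := by
  have hvu : inner ℂ v u = 0 := inner_eq_zero_symm.1 huv
  simp only [inner_add_left, inner_add_right, inner_smul_left, inner_smul_right, huv, hvu,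
    inner_self_eq_norm_sq_to_K, hu, hv, Complex.conj_ofReal]
  simp [mul_comm]

lemma norm_sq_real_comb {u v : H} (hu : ‖u‖ = 1) (hv : ‖v‖ = 1) (huv : inner ℂ u v = 0)
    (a b : ℝ) : ‖(a : ℂ) • u + (b : ℂ) • v‖ ^ 2 = a ^ 2 + b ^ 2 := by
  have := re_inner_real_comb hu hv huv a b a b
  rw [sq a, sq b, ← this, ← inner_self_eq_norm_sq (𝕜 := ℂ)]
  rfl

/-- Two eigenvectors around `t` combine to a vector with expectation value `t`. -/
lemma minUncertainty_le_of_eigenvectors {A : H →ₗ.[ℂ] H} (hA : A.IsFormalAdjoint A) {a b t : ℝ}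
    (hat : a ≤ t) (htb : t ≤ b) {u v : H} (hu : ‖u‖ = 1) (hv : ‖v‖ = 1)
    (hau : (u, (a : ℂ) • u) ∈ A.graph) (hbv : (v, (b : ℂ) • v) ∈ A.graph) :
    minUncertainty A t ≤ ENNReal.ofReal √(|a - t| * |b - t|) := by
  rcases (hat.trans htb).eq_or_lt with rfl | hab
  · have : t = a := le_antisymm htb hat
    subst this
    refine (minUncertainty_le_of_unit hau hu ?_).trans ?_
    · rw [inner_smul_right, inner_self_eq_norm_sq_to_K, hu]
      simp
    · simp
  have huv : inner ℂ u v = 0 := by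
    have := inner_eq_of_mem_graph hA hau hbv
    rw [inner_smul_left, inner_smul_right, Complex.conj_ofReal, ← sub_eq_zero, ← sub_mul] at this
    refine (mul_eq_zero.1 this).resolve_left ?_
    exact sub_ne_zero.2 (by exact_mod_cast hab.ne)
  -- The squared weights `b - t` and `t - a` are proportional to the barycentric coordinates of `t`
  -- in `[a, b]`, so the mean is `t`. Both vanish when `a = b`, hence the separate case above.
  have hp : √(b - t) ^ 2 = b - t := Real.sq_sqrt (by linarith)
  have hq : √(t - a) ^ 2 = t - a := Real.sq_sqrt (by linarith)
  set p := √(b - t)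
  set q := √(t - a)
  have hmem := A.graph.add_mem (A.graph.smul_mem (p : ℂ) hau) (A.graph.smul_mem (q : ℂ) hbv)
  have hy : (p : ℂ) • (a : ℂ) • u + (q : ℂ) • (b : ℂ) • v
      = ((p * a : ℝ) : ℂ) • u + ((q * b : ℝ) : ℂ) • v := by
    push_cast
    simp only [mul_smul]
  rw [Prod.smul_mk, Prod.smul_mk, Prod.mk_add_mk, hy] at hmem
  have hn := norm_sq_real_comb hu hv huv p q
  have hn' : ‖(p : ℂ) • u + (q : ℂ) • v‖ ^ 2 = b - a := by rw [hn, hp, hq]; ring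
  refine (minUncertainty_le hmem ?_ ?_).trans (ENNReal.ofReal_le_ofReal ?_)
  · intro h0
    rw [h0, norm_zero] at hn'
    linarith
  · rw [re_inner_real_comb hu hv huv, hn']
    linear_combination a * hp + b * hq
  · have e : ((p * a : ℝ) : ℂ) • u + ((q * b : ℝ) : ℂ) • v - (t : ℂ) • ((p : ℂ) • u + (q : ℂ) • v)
        = ((p * (a - t) : ℝ) : ℂ) • u + ((q * (b - t) : ℝ) : ℂ) • v := by
      push_cast
      module
    rw [e]
    refine Real.le_sqrt_of_sq_le (le_of_eq ?_)
    rw [div_pow, hn', norm_sq_real_comb hu hv huv, abs_of_nonpos (by linarith),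
      abs_of_nonneg (by linarith), mul_pow, mul_pow, hp, hq, div_eq_iff (by linarith)]
    ring

/-! ### The formula for a single extension -/

/-- A unit eigenvector at `s` satisfies `R ((s - t) • u) = u`, which forces `1 ≤ |s - t| ‖R‖`. -/
lemma exists_notMem_spectrum_nhds [CompleteSpace H] {A : H →ₗ.[ℂ] H}
    (hev : ∀ s : ℝ, (s : ℂ) ∈ spectrum A → ∃ u, ‖u‖ = 1 ∧ (u, (s : ℂ) • u) ∈ A.graph) {t : ℝ}
    (ht : (t : ℂ) ∉ spectrum A) : ∃ ε > 0, ∀ s : ℝ, |s - t| < ε → (s : ℂ) ∉ spectrum A := by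
  obtain ⟨R, hR⟩ := notMem_spectrum_iff.1 ht
  refine ⟨(‖R‖ + 1)⁻¹, by positivity, fun s hs hmem => ?_⟩
  obtain ⟨u, hu, hsu⟩ := hev s hmem
  have h1 := R.le_opNorm ((s : ℂ) • u - (t : ℂ) • u)
  rw [hR.1 _ _ hsu, ← sub_smul, norm_smul, hu, mul_one, ← Complex.ofReal_sub, Complex.norm_real,
    Real.norm_eq_abs] at h1
  have h2 : |s - t| * (‖R‖ + 1) < 1 := by
    rwa [← lt_div_iff₀ (by positivity), one_div]
  nlinarith [abs_nonneg (s - t), norm_nonneg R]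

/-- The spectrum misses a neighbourhood of `t` and one whole side of it, so the gap has an
arbitrarily distant endpoint and the variance would exceed every bound. -/
lemma minUncertainty_eq_top_of_empty [CompleteSpace H] {A : H →ₗ.[ℂ] H} (hA : IsSelfAdjoint A)
    (hev : ∀ s : ℝ, (s : ℂ) ∈ spectrum A → ∃ u, ‖u‖ = 1 ∧ (u, (s : ℂ) • u) ∈ A.graph) {t : ℝ}
    (he : ¬ (spectralPairValues A t).Nonempty) : minUncertainty A t = ⊤ := by
  have ht : (t : ℂ) ∉ spectrum A := fun h => he ⟨_, t, t, h, h, le_rfl, le_rfl, rfl⟩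
  obtain ⟨ε, hε, hgap⟩ := exists_notMem_spectrum_nhds hev ht
  refine top_le_iff.1 (le_minUncertainty fun x y hxy hx hexp => ?_)
  exfalso
  have hside : (∀ s : ℝ, s < t + ε → (s : ℂ) ∉ spectrum A) ∨
      (∀ s : ℝ, t - ε < s → (s : ℂ) ∉ spectrum A) := by
    by_contra! h
    obtain ⟨⟨a, ha, ha'⟩, b, hb, hb'⟩ := h
    have hat : a ≤ t := by
      by_contra! h
      exact hgap a (by rw [abs_lt]; constructor <;> linarith) ha'
    have htb : t ≤ b := by
      by_contra! h
      exact hgap b (by rw [abs_lt]; constructor <;> linarith) hb'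
    exact he ⟨_, a, b, ha', hb', hat, htb, rfl⟩
  set V := ‖y - (t : ℂ) • x‖ ^ 2
  have hV : 0 ≤ V := by positivity
  -- An endpoint at distance `(V + 1) / ε` turns the gap bound into `V + 1 ≤ V`.
  have hN : 0 ≤ (V + 1) / ε := by positivity
  rcases hside with h | h
  · have := gap_le_variance hA (a := t - (V + 1) / ε) (b := t + ε) (by linarith) (by linarith)
      (fun s _ hs => h s hs) hxy hx hexp
    rw [sub_sub_cancel, add_sub_cancel_left, div_mul_cancel₀ _ hε.ne'] at this
    linarith
  · have := gap_le_variance hA (a := t - ε) (b := t + (V + 1) / ε) (by linarith) (by linarith)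
      (fun s hs _ => h s hs) hxy hx hexp
    rw [sub_sub_cancel, add_sub_cancel_left, mul_div_cancel₀ _ hε.ne'] at this
    linarith

lemma isClosed_real_spectrum [CompleteSpace H] {A : H →ₗ.[ℂ] H}
    (hev : ∀ s : ℝ, (s : ℂ) ∈ spectrum A → ∃ u, ‖u‖ = 1 ∧ (u, (s : ℂ) • u) ∈ A.graph) :
    IsClosed {s : ℝ | (s : ℂ) ∈ spectrum A} := by
  rw [← isOpen_compl_iff, Metric.isOpen_iff]
  intro s hs
  obtain ⟨ε, hε, h⟩ := exists_notMem_spectrum_nhds hev hs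
  exact ⟨ε, hε, fun r hr => h r hr⟩

lemma isLeast_minUncertainty [CompleteSpace H] {A : H →ₗ.[ℂ] H} (hA : IsSelfAdjoint A)
    (hev : ∀ s : ℝ, (s : ℂ) ∈ spectrum A → ∃ u, ‖u‖ = 1 ∧ (u, (s : ℂ) • u) ∈ A.graph) {t : ℝ}
    (he : (spectralPairValues A t).Nonempty) :
    IsLeast (spectralPairValues A t) (minUncertainty A t) := by
  have hlow : minUncertainty A t ∈ lowerBounds (spectralPairValues A t) := by
    rintro _ ⟨a, b, ha, hb, hat, htb, rfl⟩
    obtain ⟨u, hu, hau⟩ := hev a ha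
    obtain ⟨v, hv, hbv⟩ := hev b hb
    exact minUncertainty_le_of_eigenvectors (isFormalAdjoint_of_isSelfAdjoint hA) hat htb hu hv
      hau hbv
  refine ⟨?_, hlow⟩
  obtain ⟨_, a₀, b₀, ha₀, hb₀, hat₀, htb₀, -⟩ := he
  have hcl := isClosed_real_spectrum hev
  -- The minimizing pair consists of the spectral points nearest to `t` on each side; they exist
  -- because the real spectrum is closed.
  have ha := (hcl.inter isClosed_Iic).csSup_mem (s := {s : ℝ | (s : ℂ) ∈ spectrum A} ∩ Set.Iic t)
    ⟨a₀, ha₀, hat₀⟩ ⟨t, fun s hs => hs.2⟩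
  have hb := (hcl.inter isClosed_Ici).csInf_mem (s := {s : ℝ | (s : ℂ) ∈ spectrum A} ∩ Set.Ici t)
    ⟨b₀, hb₀, htb₀⟩ ⟨t, fun s hs => hs.2⟩
  have ha' : ∀ s : ℝ, (s : ℂ) ∈ spectrum A → s ≤ t →
      s ≤ sSup ({s : ℝ | (s : ℂ) ∈ spectrum A} ∩ Set.Iic t) :=
    fun s h1 h2 => le_csSup ⟨t, fun s hs => hs.2⟩ ⟨h1, h2⟩
  have hb' : ∀ s : ℝ, (s : ℂ) ∈ spectrum A → t ≤ s →
      sInf ({s : ℝ | (s : ℂ) ∈ spectrum A} ∩ Set.Ici t) ≤ s :=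
    fun s h1 h2 => csInf_le ⟨t, fun s hs => hs.2⟩ ⟨h1, h2⟩
  set a := sSup ({s : ℝ | (s : ℂ) ∈ spectrum A} ∩ Set.Iic t)
  set b := sInf ({s : ℝ | (s : ℂ) ∈ spectrum A} ∩ Set.Ici t)
  obtain ⟨ha, hat⟩ := ha
  obtain ⟨hb, htb⟩ := hb
  have hat : a ≤ t := hat
  have htb : t ≤ b := htb
  have hmem : ENNReal.ofReal √(|a - t| * |b - t|) ∈ spectralPairValues A t :=
    ⟨a, b, ha, hb, hat, htb, rfl⟩
  refine (le_antisymm (hlow hmem) (le_minUncertainty fun x y hxy hx hexp => ?_)) ▸ hmem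
  refine ENNReal.ofReal_le_ofReal (Real.sqrt_le_iff.2 ⟨norm_nonneg _, ?_⟩)
  have := gap_le_variance hA hat htb (fun s h1 h2 h3 => by
    rcases le_total s t with h | h
    · exact absurd (ha' s h3 h) (not_le.2 h1)
    · exact absurd (hb' s h3 h) (not_le.2 h2)) hxy hx hexp
  rwa [abs_of_nonpos (by linarith), abs_of_nonneg (by linarith), neg_sub]

lemma minUncertainty_eq_sInf [CompleteSpace H] {A : H →ₗ.[ℂ] H} (hA : IsSelfAdjoint A)
    (hev : ∀ s : ℝ, (s : ℂ) ∈ spectrum A → ∃ u, ‖u‖ = 1 ∧ (u, (s : ℂ) • u) ∈ A.graph) (t : ℝ) :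
    minUncertainty A t = sInf (spectralPairValues A t) := by
  by_cases he : (spectralPairValues A t).Nonempty
  · exact (isLeast_minUncertainty hA hev he).isGLB.sInf_eq.symm
  · rw [minUncertainty_eq_top_of_empty hA hev he, Set.not_nonempty_iff_eq_empty.1 he, sInf_empty]

lemma minUncertainty_antitone {S A : H →ₗ.[ℂ] H} (h : S ≤ A) (t : ℝ) :
    minUncertainty A t ≤ minUncertainty S t :=
  le_minUncertainty fun _ _ hxy hx ht =>
    minUncertainty_le_of_unit (LinearPMap.le_graph_of_le h hxy) hx ht

/-! ### Restoring the expectation value by vectors from the domain of `S` -/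

open Filter Topology

/-- A quadratic polynomial with positive leading and nonpositive constant coefficient has a root
that is small when the constant coefficient is. -/
lemma exists_small_quadratic_root {p q : ℝ} (hp : 0 < p) (hq : q ≤ 0) (b : ℝ) :
    ∃ s : ℝ, q + s * b + s ^ 2 * p = 0 ∧ s ^ 2 * p ≤ -q := by
  have hD : √(b ^ 2 - 4 * p * q) ^ 2 = b ^ 2 - 4 * p * q := Real.sq_sqrt (by nlinarith [sq_nonneg b])
  have hge : |b| ≤ √(b ^ 2 - 4 * p * q) := Real.abs_le_sqrt (by nlinarith)
  set D := √(b ^ 2 - 4 * p * q)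
  -- The root `s` is chosen with `s * b ≥ 0`, whence `s ^ 2 * p = -q - s * b ≤ -q`.
  rcases le_total 0 b with hb | hb
  · have hs : 0 ≤ (-b + D) / (2 * p) :=
      div_nonneg (by linarith [le_abs_self b]) (by linarith)
    have h0 : q + (-b + D) / (2 * p) * b + ((-b + D) / (2 * p)) ^ 2 * p = 0 := by
      field_simp
      linear_combination hD
    exact ⟨_, h0, by nlinarith [mul_nonneg hs hb]⟩
  · have hs : 0 ≤ (b + D) / (2 * p) :=
      div_nonneg (by linarith [neg_abs_le b]) (by linarith)
    have h0 : q + (-b - D) / (2 * p) * b + ((-b - D) / (2 * p)) ^ 2 * p = 0 := by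
      field_simp
      linear_combination hD
    refine ⟨_, h0, ?_⟩
    have : (-b - D) / (2 * p) * b = (b + D) / (2 * p) * (-b) := by ring
    nlinarith [mul_nonneg hs (neg_nonneg.2 hb)]

/-- The quadratic form `⟪x, (A - t) x⟫` at the point `(x, y) = (x, A x)` of the graph of `A`. -/
noncomputable def shiftedForm (t : ℝ) (p : H × H) : ℝ := (inner ℂ p.1 p.2).re - t * ‖p.1‖ ^ 2

lemma continuous_shiftedForm (t : ℝ) : Continuous (shiftedForm t : H × H → ℝ) := by
  unfold shiftedForm
  fun_prop

lemma shiftedForm_add_smul {A : H →ₗ.[ℂ] H} (hA : A.IsFormalAdjoint A) (t s : ℝ) {p r : H × H}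
    (hp : p ∈ A.graph) (hr : r ∈ A.graph) :
    shiftedForm t (p + (s : ℂ) • r) = shiftedForm t p
      + s * (2 * (inner ℂ (p.2 - (t : ℂ) • p.1) r.1).re) + s ^ 2 * shiftedForm t r := by
  obtain ⟨x, y⟩ := p
  obtain ⟨a, b⟩ := r
  have h1 := congrArg Complex.re (inner_eq_of_mem_graph hA hp hr)
  have h2 : (inner ℂ a y).re = (inner ℂ y a).re := by rw [← inner_conj_symm, Complex.conj_re]
  have h3 := @norm_add_sq ℂ H _ _ _ x ((s : ℂ) • a)
  rw [norm_smul, inner_smul_right, Complex.norm_real, mul_pow, Real.norm_eq_abs, sq_abs,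
    RCLike.re_to_complex, Complex.re_ofReal_mul] at h3
  simp only [shiftedForm, Prod.fst_add, Prod.snd_add, Prod.smul_fst, Prod.smul_snd, h3,
    inner_add_left, inner_add_right, inner_sub_left, inner_smul_left, inner_smul_right,
    Complex.conj_ofReal, Complex.add_re, Complex.sub_re, Complex.re_ofReal_mul, h2, ← h1]
  ring

/-- If `t` is the expectation value of `S` at a vector that is not an eigenvector, then the form of
`S - t` takes both signs. -/
lemma exists_shiftedForm_pos_neg {S : H →ₗ.[ℂ] H} (hsymm : IsSymmetric S) {t : ℝ} {p : H × H}
    (hp : p ∈ S.graph) (hp0 : shiftedForm t p = 0) (hne : p.2 - (t : ℂ) • p.1 ≠ 0) :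
    (∃ r ∈ S.graph, 0 < shiftedForm t r) ∧ ∃ r ∈ S.graph, shiftedForm t r < 0 := by
  set w := p.2 - (t : ℂ) • p.1 with hw
  obtain ⟨r, hr, hm⟩ : ∃ r ∈ S.graph, 0 < (inner ℂ w r.1).re := by
    by_contra! hcon
    refine hne (hsymm.1.eq_zero_of_inner_left ℂ fun v hv => ?_)
    -- Scaling by the conjugate of `⟪w, v⟫` turns the inner product into `|⟪w, v⟫|²`.
    have h1 := hcon _ (S.graph.smul_mem (starRingEnd ℂ (inner ℂ w v)) (S.mem_graph ⟨v, hv⟩))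
    rw [Prod.smul_fst, inner_smul_right, mul_comm, Complex.mul_conj, Complex.ofReal_re] at h1
    exact Complex.normSq_eq_zero.1 (le_antisymm h1 (Complex.normSq_nonneg _))
  set m := (inner ℂ w r.1).re
  set c := shiftedForm t r
  have hexp := fun s : ℝ => shiftedForm_add_smul hsymm.2 t s hp hr
  rw [← hw] at hexp
  -- With this step size `ε |c| ≤ m`, so the linear term `± 2 ε m` dominates `ε² c` and decides the
  -- sign.
  have hε : 0 < m / (|c| + 1) := by positivity
  have hεc : m / (|c| + 1) * |c| ≤ m := by
    rw [div_mul_eq_mul_div, div_le_iff₀ (by positivity)]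
    nlinarith [abs_nonneg c]
  set ε := m / (|c| + 1)
  have h1 := mul_le_mul_of_nonneg_left (le_abs_self c) hε.le
  have h2 := mul_le_mul_of_nonneg_left (neg_abs_le c) hε.le
  refine ⟨⟨_, S.graph.add_mem hp (S.graph.smul_mem ((ε : ℝ) : ℂ) hr), ?_⟩,
    ⟨_, S.graph.add_mem hp (S.graph.smul_mem ((-ε : ℝ) : ℂ) hr), ?_⟩⟩
  · rw [hexp, hp0]
    have : 0 < ε * (2 * m + ε * c) := mul_pos hε (by linarith)
    change 0 < 0 + ε * (2 * m) + ε ^ 2 * c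
    linarith
  · rw [hexp, hp0]
    have : 0 < ε * (2 * m - ε * c) := mul_pos hε (by linarith)
    change 0 + -ε * (2 * m) + (-ε) ^ 2 * c < 0
    linarith

/-- Vectors in the domain of an extension of `S` are corrected to expectation value `t` by vectors
from the domain of `S`, with uniform control on the size of the correction. -/
lemma exists_correction {S : H →ₗ.[ℂ] H} {t : ℝ} (hpos : ∃ r ∈ S.graph, 0 < shiftedForm t r)
    (hneg : ∃ r ∈ S.graph, shiftedForm t r < 0) :
    ∃ C : ℝ, ∀ A : H →ₗ.[ℂ] H, A.IsFormalAdjoint A → S ≤ A → ∀ p ∈ A.graph, ∃ r ∈ A.graph,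
      shiftedForm t (p + r) = 0 ∧ ‖r‖ ^ 2 ≤ C * |shiftedForm t p| := by
  obtain ⟨r₁, hr₁, h₁⟩ := hpos
  obtain ⟨r₂, hr₂, h₂⟩ := hneg
  -- The correction is `s • r` with `s² |form r| ≤ |form p|`, where `r` is whichever of `r₁`, `r₂`
  -- has form of sign opposite to that of `p`. As `r₁`, `r₂` come from `S`, the constant serves all
  -- extensions at once.
  refine ⟨‖r₁‖ ^ 2 / shiftedForm t r₁ + ‖r₂‖ ^ 2 / (-shiftedForm t r₂), fun A hA hle p hp => ?_⟩
  have hle' := LinearPMap.le_graph_of_le hle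
  have hc₁ : 0 ≤ ‖r₁‖ ^ 2 / shiftedForm t r₁ := by positivity
  have hc₂ : 0 ≤ ‖r₂‖ ^ 2 / (-shiftedForm t r₂) := div_nonneg (by positivity) (by linarith)
  have hn : ∀ (s : ℝ) (r : H × H), ‖(s : ℂ) • r‖ ^ 2 = s ^ 2 * ‖r‖ ^ 2 := fun s r => by
    rw [norm_smul, Complex.norm_real, mul_pow, Real.norm_eq_abs, sq_abs]
  rcases le_total (shiftedForm t p) 0 with hq | hq
  · obtain ⟨s, hs, hs'⟩ := exists_small_quadratic_root h₁ hq
      (2 * (inner ℂ (p.2 - (t : ℂ) • p.1) r₁.1).re)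
    refine ⟨(s : ℂ) • r₁, A.graph.smul_mem _ (hle' hr₁), ?_, ?_⟩
    · rw [shiftedForm_add_smul hA t s hp (hle' hr₁), hs]
    · rw [hn, abs_of_nonpos hq, add_mul]
      refine le_add_of_le_of_nonneg ?_ (mul_nonneg hc₂ (by linarith))
      rw [div_mul_eq_mul_div, le_div_iff₀ h₁, mul_right_comm, mul_comm]
      exact mul_le_mul_of_nonneg_left hs' (by positivity)
  · obtain ⟨s, hs, hs'⟩ := exists_small_quadratic_root (neg_pos.2 h₂) (neg_nonpos.2 hq)
      (-(2 * (inner ℂ (p.2 - (t : ℂ) • p.1) r₂.1).re))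
    refine ⟨(s : ℂ) • r₂, A.graph.smul_mem _ (hle' hr₂), ?_, ?_⟩
    · rw [shiftedForm_add_smul hA t s hp (hle' hr₂)]
      linear_combination -hs
    · rw [hn, abs_of_nonneg hq, add_mul]
      refine le_add_of_nonneg_of_le (mul_nonneg hc₁ hq) ?_
      rw [div_mul_eq_mul_div, le_div_iff₀ (neg_pos.2 h₂), mul_right_comm, mul_comm]
      rw [neg_neg] at hs'
      exact mul_le_mul_of_nonneg_left hs' (by positivity)

/-! ### Compactness of the set of self-adjoint extensions -/

/-- Resolvents of self-adjoint extensions converge pointwise along ultrafilters, as they differ by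
operators into a finite-dimensional deficiency subspace. -/
lemma exists_tendsto_resolvent [CompleteSpace H] {S : H →ₗ.[ℂ] H} (hS : Dense (S.domain : Set H))
    {A : ℕ → H →ₗ.[ℂ] H} (hA : ∀ k, A k ∈ selfAdjointExtensions S) {z : ℂ} (hz : z.im ≠ 0)
    (hfin : FiniteDimensional ℂ (eigenspace S.adjoint z)) {R : ℕ → H →L[ℂ] H}
    (hR : ∀ k, IsResolventAt (A k) z (R k)) (U : Ultrafilter ℕ) (f : H) :
    ∃ x, Tendsto (fun k => R k f) U (𝓝 x) := by
  have hbd : ∀ k, ‖R k f‖ ≤ ‖f‖ / |z.im| := by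
    intro k
    have h := norm_sq_shift (isFormalAdjoint_of_isSelfAdjoint (hA k).2) ((hR k).2 f) z
    rw [add_sub_cancel_right] at h
    rw [le_div_iff₀ (abs_pos.2 hz), mul_comm]
    refine abs_le_of_sq_le_sq' ?_ (norm_nonneg _) |>.2
    rw [mul_pow, sq_abs, ← mul_pow, h]
    nlinarith [sq_nonneg ‖f + z • R k f - (z.re : ℂ) • R k f‖]
  -- Both resolvents solve `(S† - z) x = f`, so their difference lies in `ker (S† - z)`.
  have hmem : ∀ k, R k f - R 0 f ∈ eigenspace S.adjoint z := by
    intro k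
    have hgr : ∀ k, (R k f, f + z • R k f) ∈ S.adjoint.graph := by
      intro k
      have h1 : (S : H →ₗ.[ℂ] H).IsFormalAdjoint (A k) := fun x y => by
        have := isFormalAdjoint_of_isSelfAdjoint (hA k).2 ⟨x, (hA k).1.1 x.2⟩ y
        rwa [← (hA k).1.2 (x := x) (y := ⟨x, (hA k).1.1 x.2⟩) rfl] at this
      exact LinearPMap.le_graph_of_le (h1.le_adjoint hS) ((hR k).2 f)
    rw [mem_eigenspace]
    have := S.adjoint.graph.sub_mem (hgr k) (hgr 0)
    rwa [Prod.mk_sub_mk, add_sub_add_left_eq_sub, ← smul_sub] at this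
  let E := eigenspace S.adjoint z
  have : ProperSpace E := FiniteDimensional.proper ℂ E
  have hK : IsCompact ((fun v : E => R 0 f + (v : H)) ''
      Metric.closedBall (0 : E) (‖f‖ / |z.im| + ‖f‖ / |z.im|)) :=
    (isCompact_closedBall _ _).image (by fun_prop)
  obtain ⟨x, -, hx⟩ := hK.ultrafilter_le_nhds (U.map fun k => R k f) (by
    rw [Filter.le_principal_iff, Ultrafilter.coe_map, Filter.mem_map]
    refine Filter.Eventually.of_forall fun k => ⟨⟨_, hmem k⟩, ?_, by simp⟩
    rw [mem_closedBall_zero_iff]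
    exact (norm_sub_le _ _).trans (add_le_add (hbd k) (hbd 0)))
  exact ⟨x, hx⟩

/-- Compactness of the set of self-adjoint extensions: every sequence has a limit along an
ultrafilter in the sense of convergence of graphs. -/
lemma exists_graph_limit [CompleteSpace H] {S : H →ₗ.[ℂ] H} (hS : Dense (S.domain : Set H))
    (hfin : FiniteDimensional ℂ (eigenspace S.adjoint I))
    (hfin' : FiniteDimensional ℂ (eigenspace S.adjoint (-I)))
    {A : ℕ → H →ₗ.[ℂ] H} (hA : ∀ k, A k ∈ selfAdjointExtensions S) (U : Ultrafilter ℕ) :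
    ∃ B ∈ selfAdjointExtensions S, ∀ p ∈ B.graph, ∃ g : ℕ → H × H,
      (∀ k, g k ∈ (A k).graph) ∧ Tendsto g U (𝓝 p) := by
  -- Symmetry passes to the limit relation, and the limits of the resolvents at `±i` show that `G -
  -- i` and `G + i` are onto.
  let G : Submodule ℂ (H × H) :=
    { carrier := {p | ∃ g : ℕ → H × H, (∀ k, g k ∈ (A k).graph) ∧ Tendsto g U (𝓝 p)}
      add_mem' := by
        rintro p q ⟨g, hg, hgp⟩ ⟨g', hg', hgq⟩
        exact ⟨fun k => g k + g' k, fun k => (A k).graph.add_mem (hg k) (hg' k), hgp.add hgq⟩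
      zero_mem' := ⟨fun _ => 0, fun k => (A k).graph.zero_mem, tendsto_const_nhds⟩
      smul_mem' := by
        rintro c p ⟨g, hg, hgp⟩
        exact ⟨fun k => c • g k, fun k => (A k).graph.smul_mem c (hg k), hgp.const_smul c⟩ }
  choose R hR using fun k => exists_isResolventAt_of_im_ne_zero (hA k).2 (z := I) (by simp)
  choose Q hQ using fun k => exists_isResolventAt_of_im_ne_zero (hA k).2 (z := -I) (by simp)
  obtain ⟨B, hB, hBG⟩ := exists_selfAdjointExtension_of_graph hS (G := G)
    (fun p hp => ⟨fun _ => p, fun k => LinearPMap.le_graph_of_le (hA k).1 hp, tendsto_const_nhds⟩)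
    (by
      rintro a b c d ⟨g, hg, hgp⟩ ⟨g', hg', hgq⟩
      refine tendsto_nhds_unique (hgp.snd_nhds.inner hgq.fst_nhds)
        ((hgp.fst_nhds.inner hgq.snd_nhds).congr fun k => ?_)
      exact (inner_eq_of_mem_graph (isFormalAdjoint_of_isSelfAdjoint (hA k).2)
        (hg k) (hg' k)).symm)
    (fun w => by
      obtain ⟨x, hx⟩ := exists_tendsto_resolvent hS hA (by simp) hfin hR U w
      exact ⟨x, w + I • x, ⟨_, fun k => (hR k).2 w,
        hx.prodMk_nhds (tendsto_const_nhds.add (hx.const_smul I))⟩, by simp⟩)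
    (fun w => by
      obtain ⟨x, hx⟩ := exists_tendsto_resolvent hS hA (by simp) hfin' hQ U w
      exact ⟨x, w + (-I) • x, ⟨_, fun k => (hQ k).2 w,
        hx.prodMk_nhds (tendsto_const_nhds.add (hx.const_smul (-I)))⟩, by simp⟩)
  refine ⟨B, hB, fun p hp => ?_⟩
  rw [hBG] at hp
  exact hp

/-! ### Existence of a maximizing extension -/

lemma exists_max_minUncertainty [CompleteSpace H] {S : H →ₗ.[ℂ] H} (hsymm : IsSymmetric S)
    (hclosed : S.IsClosed) (hreg : IsRegular S) {n : ℕ} (hdef : HasDeficiencyIndices S n n) {t : ℝ}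
    {φ : S.domain} (hφ : ‖(φ : H)‖ = 1) (ht : expectation S φ = t) :
    ∃ B ∈ selfAdjointExtensions S, ∀ A ∈ selfAdjointExtensions S,
      minUncertainty A t ≤ minUncertainty B t := by
  have hform0 : shiftedForm t ((φ : H), S φ) = 0 := by
    rw [shiftedForm, hφ]
    change expectation S φ - t * 1 ^ 2 = 0
    rw [ht]
    ring
  -- Regularity excludes eigenvalues of `S`, so `φ` is not an eigenvector and the form of `S - t` is
  -- indefinite on `dom S`.
  have hne : S φ - (t : ℂ) • (φ : H) ≠ 0 := by
    intro h
    have hmem := S.mem_graph φ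
    rw [sub_eq_zero.1 h] at hmem
    rw [eq_zero_of_isRegularType (hreg t) hmem, norm_zero] at hφ
    exact zero_ne_one hφ
  obtain ⟨hpos, hneg⟩ := exists_shiftedForm_pos_neg hsymm (S.mem_graph φ) hform0 hne
  obtain ⟨C, hC⟩ := exists_correction hpos hneg
  obtain ⟨u, -, hu, hu'⟩ := exists_seq_tendsto_sSup
    ((selfAdjointExtensions_nonempty hsymm hclosed hdef).image (minUncertainty · t))
    (OrderTop.bddAbove _)
  choose A hA hAu using hu'
  set M := sSup ((minUncertainty · t) '' selfAdjointExtensions S)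
  let U : Ultrafilter ℕ := Filter.hyperfilter ℕ
  have hU : (U : Filter ℕ) ≤ atTop := by
    rw [← Nat.cofinite_eq_atTop]
    exact Filter.hyperfilter_le_cofinite
  obtain ⟨B, hB, hBlim⟩ := exists_graph_limit hsymm.1 (finiteDimensional_of_rank_eq hdef.1)
    (finiteDimensional_of_rank_eq hdef.2) hA U
  refine ⟨B, hB, fun A' hA' => (le_sSup (Set.mem_image_of_mem (minUncertainty · t) hA')).trans
    (le_minUncertainty fun x y hxy hx hexp => ?_)⟩
  change M ≤ _
  obtain ⟨g, hg, hglim⟩ := hBlim _ hxy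
  -- The corrected points `g k + r k` have mean exactly `t` after normalization, so they are
  -- admissible for `A k`. The corrections vanish in the limit since the forms of the `g k` tend to
  -- `0`.
  choose r hr hr0 hrC using fun k =>
    hC (A k) (isFormalAdjoint_of_isSelfAdjoint (hA k).2) (hA k).1 (g k) (hg k)
  have hq : Tendsto (fun k => shiftedForm t (g k)) U (𝓝 0) := by
    have := ((continuous_shiftedForm t).tendsto (x, y)).comp hglim
    rwa [shiftedForm, hexp, hx, one_pow, mul_one, sub_self] at this
  have hrlim : Tendsto r U (𝓝 0) := by
    rw [tendsto_zero_iff_norm_tendsto_zero]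
    have h1 : Tendsto (fun k => √(C * |shiftedForm t (g k)|)) U (𝓝 0) := by
      simpa using (hq.abs.const_mul C).sqrt
    exact squeeze_zero (fun _ => norm_nonneg _) (fun k => Real.le_sqrt_of_sq_le (hrC k)) h1
  have hlim : Tendsto (fun k => g k + r k) U (𝓝 (x, y)) := by simpa using hglim.add hrlim
  have hnorm := hlim.fst_nhds.norm
  have hbound : Tendsto (fun k => ENNReal.ofReal
      (‖(g k + r k).2 - (t : ℂ) • (g k + r k).1‖ / ‖(g k + r k).1‖)) U
      (𝓝 (ENNReal.ofReal ‖y - (t : ℂ) • x‖)) := by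
    have := ((hlim.snd_nhds.sub (hlim.fst_nhds.const_smul (t : ℂ))).norm).div hnorm
      (by simp [hx])
    rw [hx, div_one] at this
    exact ENNReal.tendsto_ofReal this
  refine le_of_tendsto_of_tendsto (hu.mono_left hU) hbound ?_
  have hev : ∀ᶠ k in (U : Filter ℕ), 0 < ‖(g k + r k).1‖ :=
    hnorm.eventually (lt_mem_nhds (by simp [hx]))
  filter_upwards [hev] with k hk
  rw [← hAu k]
  refine minUncertainty_le ((A k).graph.add_mem (hg k) (hr k)) (norm_pos_iff.1 hk) ?_
  have := hr0 k
  rw [shiftedForm] at this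
  exact sub_eq_zero.1 this

end SymmetricOperator

theorem theorem3 {H : Type*} [NormedAddCommGroup H] [InnerProductSpace ℂ H] [CompleteSpace H]
    [TopologicalSpace.SeparableSpace H] (S : H →ₗ.[ℂ] H)
    (hsymm : SymmetricOperator.IsSymmetric S) (hclosed : S.IsClosed)
    (hreg : SymmetricOperator.IsRegular S) (hsimple : SymmetricOperator.IsSimple S)
    (n : ℕ) (hdef : SymmetricOperator.HasDeficiencyIndices S n n) (t : ℝ) :
    -- the lower bound, and the equality of the two suprema
    (⨆ S' ∈ SymmetricOperator.selfAdjointExtensions S, SymmetricOperator.minUncertainty S' t)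
        ≤ SymmetricOperator.minUncertainty S t ∧
    (⨆ S' ∈ SymmetricOperator.selfAdjointExtensions S, SymmetricOperator.minUncertainty S' t)
        = (⨆ S' ∈ SymmetricOperator.selfAdjointExtensions S,
            sInf (SymmetricOperator.spectralPairValues S' t)) ∧
    -- the supremum is a maximum as soon as `t` is an expectation value of `S`
    ((∃ φ : S.domain, ‖(φ : H)‖ = 1 ∧ SymmetricOperator.expectation S φ = t) →
      ∃ S' ∈ SymmetricOperator.selfAdjointExtensions S,
        ∀ S'' ∈ SymmetricOperator.selfAdjointExtensions S,
          SymmetricOperator.minUncertainty S'' t ≤ SymmetricOperator.minUncertainty S' t) ∧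
    -- the formula for each extension; the infimum is a minimum unless it is over the empty set
    (∀ S' ∈ SymmetricOperator.selfAdjointExtensions S,
      SymmetricOperator.minUncertainty S' t = sInf (SymmetricOperator.spectralPairValues S' t) ∧
      ((SymmetricOperator.spectralPairValues S' t).Nonempty →
        IsLeast (SymmetricOperator.spectralPairValues S' t)
          (SymmetricOperator.minUncertainty S' t))) := by
  have hev : ∀ A ∈ SymmetricOperator.selfAdjointExtensions S, ∀ s : ℝ,
      (s : ℂ) ∈ SymmetricOperator.spectrum A → ∃ u, ‖u‖ = 1 ∧ (u, (s : ℂ) • u) ∈ A.graph :=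
    fun A hA s => SymmetricOperator.exists_unit_eigenvector hA.2
      (SymmetricOperator.isClosed_range_shift_extension hsymm hclosed hreg
        (SymmetricOperator.finiteDimensional_of_rank_eq hdef.2) hA s)
  have hformula : ∀ A ∈ SymmetricOperator.selfAdjointExtensions S,
      SymmetricOperator.minUncertainty A t = sInf (SymmetricOperator.spectralPairValues A t) :=
    fun A hA => SymmetricOperator.minUncertainty_eq_sInf hA.2 (hev A hA) t
  refine ⟨iSup₂_le fun A hA => SymmetricOperator.minUncertainty_antitone hA.1 t,
    iSup_congr fun A => iSup_congr fun hA => hformula A hA, ?_, fun A hA => ⟨hformula A hA, fun he =>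
      SymmetricOperator.isLeast_minUncertainty hA.2 (hev A hA) he⟩⟩
  rintro ⟨φ, hφ, ht⟩
  exact SymmetricOperator.exists_max_minUncertainty hsymm hclosed hreg hdef hφ ht
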